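/- **Setting.** A *total query search problem* is a sequence $R=(R_n)_{n\in\mathbb N}$ of relations $R_n\subseteq\{0,1\}^{N_n}\times\mathcal O_n$ such that every $x\in\{0,1\}^{N_n}$ has some $o\in\mathcal O_n$ with $R_n(x,o)$. Here $N_n$ is the number of input bits of $R_n$, and $\mathrm{polylog}(N)$ means $(\log N)^{O(1)}$. For a function $h$ on bit strings, $\mathrm{depth}(h)$ is the least depth of a decision tree computing $h$. *Reductions.* Let $R\subseteq\{0,1\}^N\times\mathcal O$ and $S\subseteq\{0,1\}^M\times\mathcal O'$ be single total problems. An *$S$-formulation of $R$* consists of functions $f_i:\{0,1\}^N\to\{0,1\}$ ($i\le M$) and $g_o:\{0,1\}^N\to\mathcal O$ ($o\in\mathcal O'$) such that $S(f(x),o)\Rightarrow R(x,g_o(x))$ for all $x,o$, where $f(x)=(f_1(x),\dots,f_M(x))$. Its complexity is $\log_2 M+d$, where $d$ is the maximum of all $\mathrm{depth}(f_i)$ and $\mathrm{depth}(g_o)$. For sequences, $R\le_{dt}S$ means that there is a bound $p(N)=\mathrm{polylog}(N)$ such that for every $n$ there are an $m$ and an $S_m$-formulation of $R_n$ of complexity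 at most $p(N_n)$. The class $S^{dt}$ consists of all total query search problems $R$ with $R\le_{dt}S$. *The class $\mathsf{TF}\Sigma_2^{dt}$.* It consists of the total query search problems $R$ for which there are, for every $n$, a length $\ell=\mathrm{polylog}(N_n)$ and, for all $o\in\mathcal O_n$ and $z\in\{0,1\}^{\ell}$, a decision tree $V_{o,z}$ of depth $\mathrm{polylog}(N_n)$ (both bounds uniform) such that $R_n(x,o)\iff\forall z\in\{0,1\}^{\ell}\ V_{o,z}(x)=1$. *Linear Ordering Principle* ($\mathrm{LOP}$). The input of $\mathrm{LOP}_n$ is a relation $\prec$ on $[2^n]$, given by its $2^n\cdot 2^n$ truth values. A solution is either an $x$ such that $x\prec y$ for every $y\ne x$, or a triple $(x,y,z)$ with $x\neq y$ and $y\ne z$ such that (i) $x\prec x$, or (ii) $x\not\prec y$ and $y\not\prec x$, or (iii) $x\prec y$, $y\prec z$ and $x\not\prec z$. *Strong Avoid.* The input of $\mathrm{StrongAvoid}_n$ is a function $C:[2^n]\to[2^n+1]$, each value written in binary with $n+1$ bits (bit patterns that are not codes of an element of $[2^n+1]$ are read as its last element). A solution is a $y\in[2^n+1]$ with $C(x)\neq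 y$ for all $x\in[2^n]$. **Theorem 1.** $\mathrm{LOP}$ belongs to $\mathsf{TF}\Sigma_2^{dt}$, but $\mathrm{LOP}\notin\mathsf{StrongAvoid}^{dt}$: there is no decision-tree reduction of polylogarithmic complexity from $\mathrm{LOP}$ to Strong Avoid. -/

import Mathlib

namespace BlackBox

/-- Decision trees over Boolean variables indexed by `V`, with leaves labelled by `α`. -/
inductive DecisionTree (V α : Type) : Type
  | leaf (a : α) : DecisionTree V α
  | query (v : V) (ifFalse ifTrue : DecisionTree V α) : DecisionTree V α

namespace DecisionTree

/-- The label of the leaf that the input `x` reaches. -/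
def eval {V α : Type} : DecisionTree V α → (V → Bool) → α
  | leaf a, _ => a
  | query v s t, x => if x v then t.eval x else s.eval x

/-- The maximal number of queries on a root-to-leaf path. -/
def depth {V α : Type} : DecisionTree V α → ℕ
  | leaf _ => 0
  | query _ s t => max s.depth t.depth + 1

end DecisionTree

/-- Some decision tree of depth at most `d` computes `f`, that is, `depth(f) ≤ d`. -/
def DepthLE {V α : Type} (f : (V → Bool) → α) (d : ℕ) : Prop :=
  ∃ T : DecisionTree V α, T.depth ≤ d ∧ ∀ x, T.eval x = f x

/-- A single total query search problem: the input is a bit string, with its finitely many bits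
indexed by `Var`, and every input has a solution. -/
structure SearchProblem where
  Var : Type
  fintypeVar : Fintype Var
  Out : Type
  Sol : (Var → Bool) → Out → Prop
  total : ∀ x, ∃ o, Sol x o

attribute [instance] SearchProblem.fintypeVar

/-- The number of input bits. -/
def SearchProblem.size (R : SearchProblem) : ℕ := Fintype.card R.Var

/-- A total query search problem: a sequence of single problems. All complexities are measured
as functions of the number of input bits. -/
abbrev SearchProblemSeq : Type 1 := ℕ → SearchProblem

/-- An `S`-formulation of `R`: from a solution `o` of the instance `f x` of `S`, the map `g o`
computes a solution of the instance `x` of `R`. -/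
structure Formulation (R S : SearchProblem) where
  f : (R.Var → Bool) → (S.Var → Bool)
  g : S.Out → (R.Var → Bool) → R.Out
  correct : ∀ x o, S.Sol (f x) o → R.Sol x (g o x)

/-- The depth of a formulation is at most `d`: every output bit of `f` and every `g o` is computed
by a decision tree of depth at most `d`. -/
def Formulation.DepthLE {R S : SearchProblem} (φ : Formulation R S) (d : ℕ) : Prop :=
  (∀ i : S.Var, BlackBox.DepthLE (fun x => φ.f x i) d) ∧ ∀ o : S.Out, BlackBox.DepthLE (φ.g o) d

/-- The complexity of reducing `R` to `S` is at most `c`: some `S`-formulation of `R` satisfies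
`log (size) + depth ≤ c`, its size being the number of input bits of `S`. -/
def ComplexityLE (R S : SearchProblem) (c : ℝ) : Prop :=
  ∃ (φ : Formulation R S) (d : ℕ), φ.DepthLE d ∧ Real.logb 2 S.size + d ≤ c

/-- `p(N) = (log N)^O(1)`. -/
def IsPolylog (p : ℕ → ℝ) : Prop :=
  ∃ k : ℕ, Asymptotics.IsBigO Filter.atTop p (fun N : ℕ => Real.log N ^ k)

/-- `R ≤_dt S`: `R` has an efficient reduction to `S`, that is, for a polylogarithmic `p`, each
member of `R`, with `N` input bits, is reducible to some member of `S` with complexity `p N`. -/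
def Reducible (R S : SearchProblemSeq) : Prop :=
  ∃ p : ℕ → ℝ, IsPolylog p ∧ ∀ n, ∃ m, ComplexityLE (R n) (S m) (p (R n).size)

/-- The class `S^dt` of the problems that have an efficient reduction to `S`. -/
def dtClass (S : SearchProblemSeq) : Set SearchProblemSeq := {R | Reducible R S}

/-- The class `TFΣ₂^dt`: that `o` is a solution is expressed by a universal quantification over
strings `z` of polylogarithmic length, followed by decision trees of polylogarithmic depth. -/
def TFSigma2dt : Set SearchProblemSeq :=
  {R | ∃ p : ℕ → ℝ, IsPolylog p ∧ ∀ n, ∃ l : ℕ, (l : ℝ) ≤ p (R n).size ∧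
    ∃ V : (R n).Out → (Fin l → Bool) → DecisionTree (R n).Var Bool,
      (∀ o z, ((V o z).depth : ℝ) ≤ p (R n).size) ∧
      ∀ x o, (R n).Sol x o ↔ ∀ z, (V o z).eval x = true}

/-- The possible outputs of the linear ordering problem on the set `U`. -/
inductive LOPOut (U : Type) : Type
  | minimal (x : U) : LOPOut U
  | violation (x y z : U) : LOPOut U

/-- `LOPSol r o` says that `o` is a solution for the relation `r`, where `r x y = true` means
`x ≺ y`. In a violation, `z = x` is allowed, which covers `x ≺ y`, `y ≺ x`, `x ⊀ x`. -/
def LOPSol {U : Type} (r : U → U → Bool) : LOPOut U → Prop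
  | .minimal x => ∀ y, y ≠ x → r x y = true
  | .violation x y z => x ≠ y ∧ y ≠ z ∧
      (r x x = true ∨ (r x y = false ∧ r y x = false) ∨
        (r x y = true ∧ r y z = true ∧ r x z = false))

theorem exists_LOPSol {U : Type} [Fintype U] [Nonempty U] (r : U → U → Bool) :
    ∃ o, LOPSol r o := by
  classical
  by_contra hno
  have hv : ∀ x y z, x ≠ y → y ≠ z → ¬ (r x x = true ∨ (r x y = false ∧ r y x = false) ∨
      (r x y = true ∧ r y z = true ∧ r x z = false)) :=
    fun x y z h1 h2 h3 => hno ⟨.violation x y z, h1, h2, h3⟩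
  obtain ⟨x, -, hx⟩ := Finset.exists_max_image (Finset.univ : Finset U)
    (fun x => (Finset.univ.filter fun y => r x y = true).card) Finset.univ_nonempty
  have hm : ¬ ∀ y, y ≠ x → r x y = true := fun h => hno ⟨.minimal x, h⟩
  push Not at hm
  obtain ⟨y, hyx, hxy⟩ := hm
  have h1 := hv x y x hyx.symm hyx
  have hlt : (Finset.univ.filter fun z => r x z = true).card
      < (Finset.univ.filter fun z => r y z = true).card := by
    apply Finset.card_lt_card
    rw [Finset.ssubset_iff_of_subset]
    · exact ⟨x, by simp; grind, by simp; grind⟩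
    · intro z hz
      have hz' : r x z = true := by simpa using hz
      have h2 := hv y x z hyx (by rintro rfl; grind)
      simp
      grind
  exact absurd (hx y (Finset.mem_univ y)) (not_le.mpr hlt)

/-- The linear ordering principle: the input is a relation on `[2^n]`, given by its `2^n * 2^n`
truth values. -/
def LOP : SearchProblemSeq := fun n =>
  { Var := Fin (2 ^ n) × Fin (2 ^ n)
    fintypeVar := inferInstance
    Out := LOPOut (Fin (2 ^ n))
    Sol := fun x => LOPSol (fun a b => x (a, b))
    total := fun x => exists_LOPSol (fun a b => x (a, b)) }

/-- The function `[2^n] → [2^n + 1]` that a bit string encodes: the value at `a` is written in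
binary with `n + 1` bits, and the codes above `2^n` are read as `2^n`. -/
def decodeFun {n : ℕ} (x : Fin (2 ^ n) × Fin (n + 1) → Bool) (a : Fin (2 ^ n)) : Fin (2 ^ n + 1) :=
  ⟨min (∑ j : Fin (n + 1), if x (a, j) then 2 ^ (j : ℕ) else 0) (2 ^ n),
    Nat.lt_succ_of_le (min_le_right _ _)⟩

/-- Strong Avoid: the input is a function `C : [2^n] → [2^n + 1]`, given by the bits of its values,
and a solution is a point outside the range of `C`. -/
def StrongAvoid : SearchProblemSeq := fun n =>
  { Var := Fin (2 ^ n) × Fin (n + 1)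
    fintypeVar := inferInstance
    Out := Fin (2 ^ n + 1)
    Sol := fun x y => ∀ a, decodeFun x a ≠ y
    total := fun x => by
      by_contra h
      push Not at h
      have hc := Fintype.card_le_of_surjective (decodeFun x) h
      simp at hc }

end BlackBox

/-!
`LOP` lies in `TFΣ₂` because minimality of `x` is a universal statement over the elements `y`, each
instance of which is one bit of the input.

For the separation, suppose that Strong Avoid solves `LOP` on `N` elements with depth `d`, and let
`F y` be the number of preimages of `y` under the produced function `C : [2^m] → [2^m + 1]`, minus
one. On every input the `F y` sum to `-1`. It is shown that each `F y` nevertheless has nonnegative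
average over the uniformly random linear orders (`sum_orderInput_nonneg`), a contradiction.

On a linear order, `F y` is nonnegative unless the tree for the output `y` finds the least element
`x`, because linear orders have no other solution. In that case, move a set `B` of elements not seen
by the tree below all others. The tree still answers `x`, but for `B ≠ ∅` this answer is wrong, so
`F y` is nonnegative there. As a function of `B`, `F y` has multilinear degree at most `D`, with `D`
polynomial in `m` and `d`, so its average over the `k`-element sets `B` is a polynomial in `k` of
degree at most `D` (Minsky–Papert symmetrization). A polynomial of degree less than `L` that is
nonnegative at `1, …, K` cannot have an isolated negative value at `0`: the `2L`-th difference of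
`x ↦ P (h x²)` shows that its values at the points `h j²` add up to at least `-P 0`
(`neg_eval_zero_le`). Averaging over `h` shows that the orders reached by moving elements down repay
the loss several times over (`neg_empty_le_sum_average`).

The map from an order and a set `B` to the order after the move is compared with the uniform measure
by recording the former positions of `B` (`eq_of_moveDown_eq`): each order is hit at most
`N.choose k` times, which is at most twice the number of available sets `B`, as the tree sees few
elements. All this works as soon as `N` exceeds a fixed polynomial in `m` and `d`, whereas
`N = 2 ^ n` and a polylogarithmic complexity bounds `m` and `d` by a polynomial in `n`.
-/

namespace BlackBox

open Finset Polynomial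

/-! ### Multilinear degree and symmetrization -/

/-- The functions on finsets of multilinear degree at most `d`: the span of the monomials
`B ↦ ∏ a ∈ A, [a ∈ B] = [A ⊆ B]` with `|A| ≤ d`. -/
def degreeLE (V : Type) [DecidableEq V] (d : ℕ) : Submodule ℝ (Finset V → ℝ) :=
  Submodule.span ℝ {g | ∃ A : Finset V, #A ≤ d ∧ g = fun B => if A ⊆ B then 1 else 0}

section Degree

variable {V : Type} [DecidableEq V]

theorem degreeLE_mono {d e : ℕ} (h : d ≤ e) : degreeLE V d ≤ degreeLE V e :=
  Submodule.span_mono fun _ ⟨A, hA, hg⟩ => ⟨A, hA.trans h, hg⟩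

theorem one_mem_degreeLE (d : ℕ) : (1 : Finset V → ℝ) ∈ degreeLE V d :=
  Submodule.subset_span ⟨∅, by simp, by ext; simp⟩

theorem const_mem_degreeLE (d : ℕ) (c : ℝ) : (fun _ : Finset V => c) ∈ degreeLE V d := by
  convert (degreeLE V d).smul_mem c (one_mem_degreeLE d) using 1
  ext; simp

theorem ite_mem_mem_degreeLE (v : V) :
    (fun B : Finset V => if v ∈ B then (1 : ℝ) else 0) ∈ degreeLE V 1 :=
  Submodule.subset_span ⟨{v}, by simp, by simp⟩

theorem mul_mem_degreeLE {d e : ℕ} {g h : Finset V → ℝ} (hg : g ∈ degreeLE V d)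
    (hh : h ∈ degreeLE V e) : g * h ∈ degreeLE V (d + e) := by
  have hle : degreeLE V d * degreeLE V e ≤ degreeLE V (d + e) := by
    rw [degreeLE, degreeLE, Submodule.span_mul_span, Submodule.span_le]
    rintro _ ⟨_, ⟨A, hA, rfl⟩, _, ⟨A', hA', rfl⟩, rfl⟩
    refine Submodule.subset_span ⟨A ∪ A', (card_union_le _ _).trans (by lia), ?_⟩
    ext B
    simp only [Pi.mul_apply, union_subset_iff]
    grind
  exact hle (Submodule.mul_mem_mul hg hh)

theorem prod_mem_degreeLE {ι : Type} (s : Finset ι) {d : ℕ} {g : ι → Finset V → ℝ}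
    (hg : ∀ i ∈ s, g i ∈ degreeLE V d) : ∏ i ∈ s, g i ∈ degreeLE V (#s * d) := by
  classical
  induction s using Finset.induction_on with
  | empty => simpa using one_mem_degreeLE 0
  | insert i s hi ih =>
    rw [prod_insert hi, card_insert_of_notMem hi, add_mul, one_mul, add_comm]
    exact mul_mem_degreeLE (hg i (by simp)) (ih fun j hj => hg j (by simp [hj]))

/-- Symmetrization: the average of a function of degree at most `d` over the `k`-element subsets
of `W` is a polynomial in `k` of degree at most `d`. -/
theorem exists_polynomial_of_mem_degreeLE (W : Finset V) {d : ℕ} {g : Finset V → ℝ}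
    (hg : g ∈ degreeLE V d) :
    ∃ P : ℝ[X], P.natDegree ≤ d ∧
      ∀ k ≤ #W, ∑ B ∈ W.powersetCard k, g B = (#W).choose k * P.eval (k : ℝ) := by
  induction hg using Submodule.span_induction with
  | mem g hg =>
    obtain ⟨A, hA, rfl⟩ := hg
    by_cases hAW : A ⊆ W
    · refine ⟨C (((#W).descFactorial #A : ℝ)⁻¹) * descPochhammer ℝ #A,
        (natDegree_C_mul_le _ _).trans ((descPochhammer_natDegree ℝ #A).le.trans hA), ?_⟩
      intro k hk
      have hne : ((#W).descFactorial #A : ℝ) ≠ 0 := by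
        exact_mod_cast (Nat.descFactorial_pos.mpr (card_le_card hAW)).ne'
      rw [sum_boole, eval_mul, eval_C, descPochhammer_eval_eq_descFactorial]
      field_simp
      norm_cast
      rcases le_or_gt #A k with hk' | hk'
      · rw [card_filter_powersetCard_subset _ _ _ hAW hk', Nat.descFactorial_eq_factorial_mul_choose,
          Nat.descFactorial_eq_factorial_mul_choose]
        have := Nat.choose_mul (n := #W) hk'
        grind
      · rw [Nat.descFactorial_eq_zero_iff_lt.mpr hk', filter_eq_empty_iff.mpr]
        · simp
        · intro B hB hAB
          have := card_le_card hAB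
          grind
    · refine ⟨0, by simp, fun k _ => ?_⟩
      rw [sum_eq_zero]
      · simp
      · intro B hB
        rw [if_neg]
        exact fun h => hAW (h.trans (mem_powersetCard.mp hB).1)
  | zero => exact ⟨0, by simp, by simp⟩
  | add g h _ _ ihg ihh =>
    obtain ⟨P, hP, hP'⟩ := ihg
    obtain ⟨Q, hQ, hQ'⟩ := ihh
    refine ⟨P + Q, natDegree_add_le_of_degree_le hP hQ, fun k hk => ?_⟩
    simp [sum_add_distrib, hP' k hk, hQ' k hk, mul_add]
  | smul c g _ ih =>
    obtain ⟨P, hP, hP'⟩ := ih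
    refine ⟨C c * P, (natDegree_C_mul_le _ _).trans hP, fun k hk => ?_⟩
    simp [← mul_sum, hP' k hk]
    ring

end Degree

/-! ### Polynomials that are nonnegative except at zero -/

/-- The `2L`-th finite difference of `x ↦ P (h x²)` about `x = 0` vanishes, and its central
coefficient is the largest one. The nodes `h x²` are spread quadratically; with equally spaced
nodes the loss would be exponential in `L`. -/
theorem neg_eval_zero_le {P : ℝ[X]} {L : ℕ} (hP : P.natDegree < L) (h : ℕ)
    (hpos : ∀ j ∈ (range (2 * L + 1)).erase L,
      0 ≤ P.eval (((((j : ℤ) - L).natAbs ^ 2 * h : ℕ)) : ℝ)) :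
    -P.eval 0 ≤ ∑ j ∈ (range (2 * L + 1)).erase L,
      P.eval (((((j : ℤ) - L).natAbs ^ 2 * h : ℕ)) : ℝ) := by
  set q : ℕ → ℝ := fun j => P.eval (((((j : ℤ) - L).natAbs ^ 2 * h : ℕ)) : ℝ) with hq
  have hQ : (P.comp (C (h : ℝ) * X ^ 2)).natDegree < 2 * L := by
    refine lt_of_le_of_lt natDegree_comp_le ?_
    have : (C (h : ℝ) * X ^ 2).natDegree ≤ 2 := natDegree_C_mul_X_pow_le _ _
    nlinarith
  have hdiff := congrFun (fwdDiff_iter_eq_zero_of_degree_lt hQ) (-(L : ℝ))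
  rw [fwdDiff_iter_eq_sum_shift] at hdiff
  have hterm : ∀ j : ℕ, (P.comp (C (h : ℝ) * X ^ 2)).eval (-(L : ℝ) + j • (1 : ℝ)) = q j := by
    intro j
    simp only [hq, eval_comp, eval_mul, eval_C, eval_pow, eval_X]
    congr 1
    push_cast [Nat.cast_natAbs]
    rw [sq_abs]
    simp
    ring
  simp only [hterm, Pi.zero_apply] at hdiff
  have hL : L ∈ range (2 * L + 1) := by simp; lia
  rw [← add_sum_erase _ _ hL] at hdiff
  have hqL : q L = P.eval 0 := by simp [hq]
  have hc : (0 : ℝ) < (2 * L).choose L := by exact_mod_cast Nat.choose_pos (by lia)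
  have key : ((2 * L).choose L : ℝ) * -q L ≤
      (2 * L).choose L * ∑ j ∈ (range (2 * L + 1)).erase L, q j := by
    have habs : |(((-1 : ℤ) ^ (2 * L - L) * ((2 * L).choose L : ℤ)) • q L : ℝ)|
        = (2 * L).choose L * |q L| := by
      simp [abs_mul]
    have hsum : |∑ j ∈ (range (2 * L + 1)).erase L,
        (((-1 : ℤ) ^ (2 * L - j) * ((2 * L).choose j : ℤ)) • q j : ℝ)| ≤
        (2 * L).choose L * ∑ j ∈ (range (2 * L + 1)).erase L, q j := by
      rw [mul_sum]
      refine (abs_sum_le_sum_abs _ _).trans (sum_le_sum fun j hj => ?_)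
      have hj0 : 0 ≤ q j := hpos j hj
      have : ((2 * L).choose j : ℝ) ≤ (2 * L).choose L := by
        exact_mod_cast Nat.choose_le_centralBinom j L
      simp only [zsmul_eq_mul, abs_mul, abs_of_nonneg hj0]
      push_cast
      simp only [abs_mul, abs_pow, abs_neg, abs_one, one_pow, one_mul, Nat.abs_cast]
      gcongr
    rw [eq_neg_of_add_eq_zero_right hdiff, abs_neg, habs] at hsum
    refine le_trans ?_ hsum
    gcongr
    exact neg_le_abs _
  rw [← hqL]
  exact le_of_mul_le_mul_left key hc

/-- A function of low degree that is nonnegative on all nonempty subsets of a large set `W` can be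
negative at `∅` only if its averages over the levels `1, …, H L²` are large in total: the loss at
`∅` is repaid `H / (2L)` times. -/
theorem neg_empty_le_sum_average {V : Type} [DecidableEq V] (W : Finset V) {d L : ℕ} (hd : d < L)
    (H : ℕ) {g : Finset V → ℝ} (hg : g ∈ degreeLE V d)
    (hpos : ∀ B ⊆ W, B.Nonempty → 0 ≤ g B) (hW : L ^ 2 * H ≤ #W) :
    H * -g ∅ ≤ 2 * L * ∑ k ∈ Icc 1 (L ^ 2 * H),
      (∑ B ∈ W.powersetCard k, g B) / (#W).choose k := by
  obtain ⟨P, hP, hPk⟩ := exists_polynomial_of_mem_degreeLE W hg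
  have havg : ∀ k ≤ #W, (∑ B ∈ W.powersetCard k, g B) / (#W).choose k = P.eval (k : ℝ) := by
    intro k hk
    have : ((#W).choose k : ℝ) ≠ 0 := by exact_mod_cast (Nat.choose_pos hk).ne'
    rw [hPk k hk]
    field_simp
  have hP0 : g ∅ = P.eval 0 := by simpa using hPk 0 (by simp)
  have hPpos : ∀ k, 1 ≤ k → k ≤ L ^ 2 * H → 0 ≤ P.eval (k : ℝ) := by
    intro k hk1 hk
    rw [← havg k (hk.trans hW)]
    refine div_nonneg (sum_nonneg fun B hB => ?_) (by positivity)
    rw [mem_powersetCard] at hB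
    exact hpos B hB.1 (card_pos.mp (by lia))
  rw [hP0, sum_congr rfl fun k hk => havg k ((mem_Icc.mp hk).2.trans hW)]
  have hnode : ∀ j ∈ (range (2 * L + 1)).erase L,
      1 ≤ ((j : ℤ) - L).natAbs ^ 2 ∧ ((j : ℤ) - L).natAbs ^ 2 ≤ L ^ 2 := by
    intro j hj
    simp only [mem_erase, mem_range] at hj
    exact ⟨Nat.one_le_pow _ _ (by lia), Nat.pow_le_pow_left (by lia) 2⟩
  have hrange : ∀ j ∈ (range (2 * L + 1)).erase L, ∀ h ∈ Icc 1 H,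
      ((j : ℤ) - L).natAbs ^ 2 * h ∈ Icc 1 (L ^ 2 * H) := by
    intro j hj h hh
    obtain ⟨h1, h2⟩ := hnode j hj
    rw [mem_Icc] at hh ⊢
    exact ⟨Nat.mul_pos h1 hh.1, Nat.mul_le_mul h2 hh.2⟩
  have hone : ∀ h ∈ Icc 1 H, -P.eval 0 ≤ ∑ j ∈ (range (2 * L + 1)).erase L,
      P.eval (((((j : ℤ) - L).natAbs ^ 2 * h : ℕ)) : ℝ) := fun h hh =>
    neg_eval_zero_le (lt_of_le_of_lt hP hd) h fun j hj =>
      hPpos _ (mem_Icc.mp (hrange j hj h hh)).1 (mem_Icc.mp (hrange j hj h hh)).2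
  have hcol : ∀ j ∈ (range (2 * L + 1)).erase L,
      ∑ h ∈ Icc 1 H, P.eval (((((j : ℤ) - L).natAbs ^ 2 * h : ℕ)) : ℝ) ≤
        ∑ k ∈ Icc 1 (L ^ 2 * H), P.eval (k : ℝ) := by
    intro j hj
    -- For a fixed `j` the nodes `(j - L)² h` are distinct.
    rw [← sum_image (s := Icc 1 H) (g := fun h => ((j : ℤ) - L).natAbs ^ 2 * h)
      (f := fun k : ℕ => P.eval (k : ℝ))]
    · refine sum_le_sum_of_subset_of_nonneg ?_ fun k hk _ =>
        hPpos k (mem_Icc.mp hk).1 (mem_Icc.mp hk).2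
      intro k hk
      obtain ⟨h, hh, rfl⟩ := mem_image.mp hk
      exact hrange j hj h hh
    · intro a _ b _ hab
      exact Nat.eq_of_mul_eq_mul_left (hnode j hj).1 hab
  calc (H : ℝ) * -P.eval 0 = ∑ h ∈ Icc 1 H, -P.eval 0 := by simp
    _ ≤ _ := sum_le_sum hone
    _ = _ := sum_comm
    _ ≤ _ := sum_le_sum hcol
    _ = _ := by
      rw [sum_const, card_erase_of_mem (by simp; lia), card_range]
      simp

/-! ### Comparison of binomial coefficients -/

/-- Union bound over the `s` elements of an `(M + s)`-element set outside an `M`-element subset. -/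
theorem choose_add_le (M s k : ℕ) :
    (M + s).choose (k + 1) ≤ M.choose (k + 1) + s * (M + s - 1).choose k := by
  induction s with
  | zero => simp
  | succ s ih =>
    have h1 : (M + s - 1).choose k ≤ (M + s).choose k := Nat.choose_le_choose _ (by lia)
    have h2 : (M + s + 1).choose (k + 1) = (M + s).choose k + (M + s).choose (k + 1) :=
      Nat.choose_succ_succ _ _
    have h3 : s * (M + s - 1).choose k ≤ s * (M + s).choose k := Nat.mul_le_mul_left _ h1
    rw [← add_assoc, h2, Nat.add_sub_cancel]
    grind

theorem choose_le_two_mul_choose {N M s k : ℕ} (hN : N ≤ M + s) (h : 2 * s * k ≤ M + s) :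
    N.choose k ≤ 2 * M.choose k := by
  refine (Nat.choose_le_choose k hN).trans ?_
  rcases k with _ | k
  · simp
  have h1 := choose_add_le M s k
  rcases Nat.eq_zero_or_pos (M + s) with h0 | h0
  · simp [h0]
  have h2 : (M + s) * (M + s - 1).choose k = (M + s).choose (k + 1) * (k + 1) := by
    have := Nat.add_one_mul_choose_eq (M + s - 1) k
    rwa [Nat.sub_add_cancel h0] at this
  have h3 : 2 * (s * (M + s - 1).choose k) ≤ (M + s).choose (k + 1) := by
    refine Nat.le_of_mul_le_mul_left ?_ h0
    calc (M + s) * (2 * (s * (M + s - 1).choose k))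
        = 2 * s * (k + 1) * (M + s).choose (k + 1) := by
          linear_combination 2 * s * h2
      _ ≤ _ := Nat.mul_le_mul_right _ h
  lia

/-! ### Decision trees as functions of low degree -/

section Trees

variable {V α : Type}

/-- The variables queried on the path that the input `x` follows. -/
def DecisionTree.queried [DecidableEq V] : DecisionTree V α → (V → Bool) → Finset V
  | leaf _, _ => ∅
  | query v s t, x => insert v (if x v then t.queried x else s.queried x)

theorem DecisionTree.card_queried_le [DecidableEq V] (T : DecisionTree V α) (x : V → Bool) :
    #(T.queried x) ≤ T.depth := by
  induction T with
  | leaf a => simp [queried]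
  | query v s t ihs iht =>
    rw [queried, depth]
    refine (card_insert_le _ _).trans ?_
    split_ifs <;> lia

theorem DecisionTree.eval_eq_of_eqOn_queried [DecidableEq V] (T : DecisionTree V α) {x y : V → Bool}
    (h : ∀ v ∈ T.queried x, y v = x v) : T.eval y = T.eval x := by
  induction T with
  | leaf a => rfl
  | query v s t ihs iht =>
    rw [queried] at h
    rw [eval, eval, h v (mem_insert_self _ _)]
    split_ifs at h ⊢ with hv
    · exact iht fun w hw => h w (mem_insert_of_mem hw)
    · exact ihs fun w hw => h w (mem_insert_of_mem hw)

/-- Bits of degree `c` turn a decision tree of depth `e` into a function of degree `c * e`. -/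
theorem DecisionTree.ite_eval_mem_degreeLE {U : Type} [DecidableEq U] {c : ℕ}
    {x : Finset U → V → Bool}
    (hx : ∀ v, (fun B => if x B v = true then (1 : ℝ) else 0) ∈ degreeLE U c)
    [DecidableEq α] (T : DecisionTree V α) (a : α) :
    (fun B => if T.eval (x B) = a then (1 : ℝ) else 0) ∈ degreeLE U (c * T.depth) := by
  induction T with
  | leaf b => exact const_mem_degreeLE (V := U) _ (if b = a then 1 else 0)
  | query v s t ihs iht =>
    have hs := degreeLE_mono (Nat.mul_le_mul_left c (le_max_left s.depth t.depth)) ihs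
    have ht := degreeLE_mono (Nat.mul_le_mul_left c (le_max_right s.depth t.depth)) iht
    have hcompl := (degreeLE U c).sub_mem (one_mem_degreeLE c) (hx v)
    rw [depth, mul_add, mul_one, add_comm]
    convert (degreeLE U _).add_mem (mul_mem_degreeLE (hx v) ht) (mul_mem_degreeLE hcompl hs) using 1
    ext B
    by_cases hv : x B v = true <;> simp [eval, hv]

end Trees

/-! ### Random linear orders and moving elements down -/

section Orders

variable {N : ℕ}

/-- The strict linear order on `Fin N` in which `v` has position `π v`, as an input of the linear
ordering problem. -/
def orderInput (π : Equiv.Perm (Fin N)) : Fin N × Fin N → Bool := fun p => decide (π p.1 < π p.2)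

theorem exists_perm_lt_iff {α : Type} [LinearOrder α] {key : Fin N → α}
    (hkey : Function.Injective key) :
    ∃ π : Equiv.Perm (Fin N), ∀ u v, π u < π v ↔ key u < key v := by
  let rank : Fin N → Fin N := fun v => ⟨#{u | key u < key v}, by
    have h : #{u | key u < key v} < #(univ : Finset (Fin N)) :=
      card_lt_card (filter_ssubset.mpr ⟨v, mem_univ _, lt_irrefl _⟩)
    simpa using h⟩
  have hlt : ∀ u v, key u < key v → rank u < rank v := by
    intro u v huv
    refine Fin.mk_lt_mk.mpr (card_lt_card ((ssubset_iff_of_subset fun w hw => ?_).mpr ⟨u, ?_⟩))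
    · simp only [mem_filter, mem_univ, true_and] at hw ⊢
      exact hw.trans huv
    · simpa using huv
  have hiff : ∀ u v, rank u < rank v ↔ key u < key v := by
    refine fun u v => ⟨fun h => ?_, hlt u v⟩
    by_contra! hle
    rcases hle.lt_or_eq with h' | h'
    · exact (h.trans (hlt v u h')).false
    · rw [hkey h'] at h
      exact h.false
  have hinj : Function.Injective rank := by
    intro u v huv
    by_contra hne
    rcases (hkey.ne hne).lt_or_gt with h | h
    · exact (hlt u v h).ne huv
    · exact (hlt v u h).ne huv.symm
  exact ⟨Equiv.ofBijective rank (Finite.injective_iff_bijective.mp hinj), hiff⟩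

theorem exists_moveDown (π : Equiv.Perm (Fin N)) (B : Finset (Fin N)) :
    ∃ ρ : Equiv.Perm (Fin N), ∀ u v, ρ u < ρ v ↔
      (u ∈ B ∧ v ∉ B) ∨ ((u ∈ B ↔ v ∈ B) ∧ π u < π v) := by
  obtain ⟨ρ, hρ⟩ := exists_perm_lt_iff (key := fun v => toLex (decide (v ∉ B), π v)) (by
    intro u v huv
    simpa using (congrArg (fun p => (ofLex p).2) huv))
  refine ⟨ρ, fun u v => ?_⟩
  rw [hρ, Prod.Lex.toLex_lt_toLex]
  by_cases hu : u ∈ B <;> by_cases hv : v ∈ B <;> simp [hu, hv]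

/-- The order obtained from `π` by moving the elements of `B` below all other elements, without
changing the order inside `B` and inside its complement. -/
noncomputable def moveDown (π : Equiv.Perm (Fin N)) (B : Finset (Fin N)) : Equiv.Perm (Fin N) :=
  (exists_moveDown π B).choose

theorem moveDown_lt_iff (π : Equiv.Perm (Fin N)) (B : Finset (Fin N)) (u v : Fin N) :
    moveDown π B u < moveDown π B v ↔ (u ∈ B ∧ v ∉ B) ∨ ((u ∈ B ↔ v ∈ B) ∧ π u < π v) :=
  (exists_moveDown π B).choose_spec u v

theorem orderInput_moveDown_empty (π : Equiv.Perm (Fin N)) :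
    orderInput (moveDown π ∅) = orderInput π := by
  ext p
  simp [orderInput, moveDown_lt_iff]

theorem orderInput_moveDown_mem_degreeLE (π : Equiv.Perm (Fin N)) (p : Fin N × Fin N) :
    (fun B => if orderInput (moveDown π B) p = true then (1 : ℝ) else 0) ∈
      degreeLE (Fin N) 2 := by
  obtain ⟨u, v⟩ := p
  have hu := ite_mem_mem_degreeLE u
  have hv := ite_mem_mem_degreeLE v
  have hu' := (degreeLE (Fin N) 1).sub_mem (one_mem_degreeLE 1) hu
  have hv' := (degreeLE (Fin N) 1).sub_mem (one_mem_degreeLE 1) hv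
  have hmem := (degreeLE (Fin N) (1 + 1)).add_mem (mul_mem_degreeLE hu hv')
    ((degreeLE (Fin N) (1 + 1)).smul_mem (if π u < π v then 1 else 0)
      ((degreeLE (Fin N) (1 + 1)).add_mem (mul_mem_degreeLE hu hv) (mul_mem_degreeLE hu' hv')))
  refine (congrArg (· ∈ degreeLE (Fin N) (1 + 1)) (funext fun B => ?_)).mp hmem
  by_cases h1 : u ∈ B <;> by_cases h2 : v ∈ B <;> by_cases h3 : π u < π v <;>
    simp [orderInput, moveDown_lt_iff, h1, h2, h3]

theorem le_of_image_eq {π₁ π₂ : Equiv.Perm (Fin N)} {C : Finset (Fin N)}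
    (himg : C.image π₁ = C.image π₂)
    (h : ∀ u ∈ C, ∀ v ∈ C, π₁ u < π₁ v → π₂ u < π₂ v) {v : Fin N} (hv : v ∈ C) :
    π₁ v ≤ π₂ v := by
  have hmem : ∀ i : C.image π₁, π₁.symm i ∈ C := by
    rintro ⟨i, hi⟩
    obtain ⟨w, hw, rfl⟩ := mem_image.mp hi
    simpa using hw
  let f : C.image π₁ → C.image π₁ := fun i =>
    ⟨π₂ (π₁.symm i), himg.superset (mem_image_of_mem π₂ (hmem i))⟩
  have hf : StrictMono f := fun i j hij =>
    h _ (hmem i) _ (hmem j) (by simpa using hij)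
  have := hf.le_apply (x := ⟨π₁ v, mem_image_of_mem π₁ hv⟩)
  simpa [f] using Subtype.coe_le_coe.mpr this

/-- An order is determined by the result of moving `B` down and by the set of the former positions
of `B`. -/
theorem eq_of_moveDown_eq {π₁ π₂ : Equiv.Perm (Fin N)} {B : Finset (Fin N)}
    (h : moveDown π₁ B = moveDown π₂ B) (himg : B.image π₁ = B.image π₂) : π₁ = π₂ := by
  have hlt : ∀ u v, (u ∈ B ↔ v ∈ B) → (π₁ u < π₁ v ↔ π₂ u < π₂ v) := by
    intro u v huv
    have h1 := moveDown_lt_iff π₁ B u v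
    rw [h, moveDown_lt_iff π₂ B u v] at h1
    tauto
  have himg' : Bᶜ.image π₁ = Bᶜ.image π₂ := by
    have hcompl : ∀ π : Equiv.Perm (Fin N), Bᶜ.image π = (B.image π)ᶜ := by
      intro π
      ext i
      simp [← Equiv.eq_symm_apply]
    rw [hcompl, hcompl, himg]
  ext1 v
  by_cases hv : v ∈ B
  · exact le_antisymm
      (le_of_image_eq himg (fun a ha b hb => (hlt a b (by simp [ha, hb])).mp) hv)
      (le_of_image_eq himg.symm (fun a ha b hb => (hlt a b (by simp [ha, hb])).mpr) hv)
  · rw [← mem_compl] at hv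
    exact le_antisymm
      (le_of_image_eq himg' (fun a ha b hb => (hlt a b (by simp_all)).mp) hv)
      (le_of_image_eq himg'.symm (fun a ha b hb => (hlt a b (by simp_all)).mpr) hv)

end Orders
/-! ### The average over linear orders -/

section Expectation

variable {N : ℕ}

/-- The elements of `Fin N` that may be moved down without affecting the run of `T` on the order
`π`: those that are neither compared with another element on this run nor least. -/
def movable {α : Type} (T : DecisionTree (Fin N × Fin N) α) (π : Equiv.Perm (Fin N)) :
    Finset (Fin N) :=
  ((T.queried (orderInput π)).image Prod.fst ∪ (T.queried (orderInput π)).image Prod.snd ∪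
    ({v | ∀ u, π v ≤ π u} : Finset (Fin N)))ᶜ

theorem le_card_movable_add {α : Type} (T : DecisionTree (Fin N × Fin N) α)
    (π : Equiv.Perm (Fin N)) : N ≤ #(movable T π) + (2 * T.depth + 1) := by
  have h1 := T.card_queried_le (orderInput π)
  have h2 : #({v | ∀ u, π v ≤ π u} : Finset (Fin N)) ≤ 1 := by
    rw [card_le_one]
    intro a ha b hb
    simp only [mem_filter, mem_univ, true_and] at ha hb
    exact π.injective (le_antisymm (ha b) (hb a))
  have h3 := card_union_le ((T.queried (orderInput π)).image Prod.fst ∪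
    (T.queried (orderInput π)).image Prod.snd) {v | ∀ u, π v ≤ π u}
  have h4 := card_union_le ((T.queried (orderInput π)).image Prod.fst)
    ((T.queried (orderInput π)).image Prod.snd)
  have h5 := card_image_le (s := T.queried (orderInput π)) (f := Prod.fst)
  have h6 := card_image_le (s := T.queried (orderInput π)) (f := Prod.snd)
  rw [movable, card_compl, Fintype.card_fin]
  lia

theorem eval_orderInput_moveDown {α : Type} (T : DecisionTree (Fin N × Fin N) α)
    {π : Equiv.Perm (Fin N)} {B : Finset (Fin N)} (hB : B ⊆ movable T π) :
    T.eval (orderInput (moveDown π B)) = T.eval (orderInput π) := by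
  refine T.eval_eq_of_eqOn_queried fun p hp => ?_
  have h1 : p.1 ∉ B := fun h => by
    have := hB h
    simp only [movable, mem_compl, mem_union, not_or] at this
    exact this.1.1 (mem_image_of_mem _ hp)
  have h2 : p.2 ∉ B := fun h => by
    have := hB h
    simp only [movable, mem_compl, mem_union, not_or] at this
    exact this.1.2 (mem_image_of_mem _ hp)
  simp [orderInput, moveDown_lt_iff, h1, h2]

/-- If `x` is least in `π`, then the elements below `x` after moving down `B` are those of `B`. -/
theorem filter_moveDown_lt {α : Type} (T : DecisionTree (Fin N × Fin N) α)
    {π : Equiv.Perm (Fin N)} {B : Finset (Fin N)} (hB : B ⊆ movable T π) {x : Fin N}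
    (hx : ∀ u, π x ≤ π u) : ({u | moveDown π B u < moveDown π B x} : Finset (Fin N)) = B := by
  have hxB : x ∉ B := fun h => by
    have := hB h
    simp only [movable, mem_compl, mem_union, not_or] at this
    exact this.2 (by simpa using hx)
  ext u
  simp [moveDown_lt_iff, hxB, not_lt.mpr (hx u)]

/-- Let `F` have low degree under moving sets of elements down. If `F` is nonnegative except
possibly on the linear orders whose least element the shallow tree `T` finds, then the average of
`F` over all linear orders is nonnegative. -/
theorem sum_orderInput_nonneg {D : ℕ} (T : DecisionTree (Fin N × Fin N) (LOPOut (Fin N)))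
    (F : (Fin N × Fin N → Bool) → ℝ)
    (hdeg : ∀ π, (fun B => F (orderInput (moveDown π B))) ∈ degreeLE (Fin N) D)
    (hF : ∀ π, (∀ x, T.eval (orderInput π) = .minimal x → ∃ u, π u < π x) →
      0 ≤ F (orderInput π))
    (hN : 2 * (2 * T.depth + 1) * ((D + 1) ^ 2 * (4 * (D + 1))) ≤ N) :
    0 ≤ ∑ π : Equiv.Perm (Fin N), F (orderInput π) := by
  classical
  -- With `H = 4 L`, the factor `H / (2L) = 2` gained by averaging makes up for the factor `2`
  -- lost in comparing `N.choose k` to `(#W).choose k`.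
  set L := D + 1 with hL
  set H := 4 * L with hH
  set K := L ^ 2 * H with hK
  have hK0 : 1 ≤ K := Nat.mul_pos (pow_pos (by lia) 2) (by lia)
  have hKN : 2 * (2 * T.depth + 1) * K ≤ N := hN
  have hKs : 2 * T.depth + 1 + K ≤ N := by nlinarith
  set low : Finset (Equiv.Perm (Fin N)) :=
    {π | ∃ x, T.eval (orderInput π) = .minimal x ∧ ∀ u, π x ≤ π u} with hlow
  set level : ℕ → Finset (Equiv.Perm (Fin N)) := fun k =>
    {π | ∃ x, T.eval (orderInput π) = .minimal x ∧ #{u | π u < π x} = k} with hlevel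
  have hnonneg : ∀ π ∉ low, 0 ≤ F (orderInput π) := by
    intro π hπ
    refine hF π fun x hx => ?_
    by_contra! h
    exact hπ (by simp only [hlow, mem_filter, mem_univ, true_and]; exact ⟨x, hx, h⟩)
  have hlevel_low : ∀ k, 1 ≤ k → ∀ π ∈ level k, π ∉ low := by
    intro k hk π hπ hπ'
    simp only [hlow, hlevel, mem_filter, mem_univ, true_and] at hπ hπ'
    obtain ⟨x, hx, hxk⟩ := hπ
    obtain ⟨y, hy, hmin⟩ := hπ'
    obtain rfl : x = y := by rw [hx] at hy; exact LOPOut.minimal.inj hy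
    rw [filter_eq_empty_iff.mpr fun u _ => not_lt.mpr (hmin u)] at hxk
    simp at hxk
    lia
  have hmove : ∀ π ∈ low, ∀ B ⊆ movable T π, moveDown π B ∈ level #B := by
    intro π hπ B hB
    simp only [hlow, hlevel, mem_filter, mem_univ, true_and] at hπ ⊢
    obtain ⟨x, hx, hmin⟩ := hπ
    exact ⟨x, (eval_orderInput_moveDown T hB).trans hx, by rw [filter_moveDown_lt T hB hmin]⟩
  -- Double counting: `(π, B) ↦ (moveDown π B, π(B))` is injective.
  have hcount : ∀ k, 1 ≤ k →
      ∑ π ∈ low, ∑ B ∈ (movable T π).powersetCard k, F (orderInput (moveDown π B)) ≤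
        N.choose k * ∑ π ∈ level k, F (orderInput π) := by
    intro k hk
    rw [sum_sigma']
    have hinj : Set.InjOn (fun p : (_ : Equiv.Perm (Fin N)) × Finset (Fin N) =>
        (moveDown p.1 p.2, p.2.image p.1)) (low.sigma fun π => (movable T π).powersetCard k) := by
      rintro ⟨π₁, B₁⟩ h₁ ⟨π₂, B₂⟩ h₂ h
      simp only [coe_sigma, Set.mem_sigma_iff, mem_coe, mem_powersetCard] at h₁ h₂
      simp only [Prod.mk.injEq] at h
      obtain ⟨hπ₁, hB₁, -⟩ := h₁
      obtain ⟨hπ₂, hB₂, -⟩ := h₂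
      simp only [hlow, mem_filter, mem_univ, true_and] at hπ₁ hπ₂
      obtain ⟨x₁, hx₁, hmin₁⟩ := hπ₁
      obtain ⟨x₂, hx₂, hmin₂⟩ := hπ₂
      obtain rfl : x₁ = x₂ := by
        rw [← eval_orderInput_moveDown T hB₁, h.1, eval_orderInput_moveDown T hB₂, hx₂] at hx₁
        exact (LOPOut.minimal.inj hx₁).symm
      obtain rfl : B₁ = B₂ := by
        rw [← filter_moveDown_lt T hB₁ hmin₁, ← filter_moveDown_lt T hB₂ hmin₂, h.1]
      obtain rfl := eq_of_moveDown_eq h.1 h.2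
      rfl
    calc ∑ p ∈ low.sigma fun π => (movable T π).powersetCard k, F (orderInput (moveDown p.1 p.2))
        = ∑ q ∈ (low.sigma fun π => (movable T π).powersetCard k).image
            (fun p => (moveDown p.1 p.2, p.2.image p.1)), F (orderInput q.1) :=
          (sum_image hinj (f := fun q => F (orderInput q.1))).symm
      _ ≤ ∑ q ∈ level k ×ˢ (univ : Finset (Fin N)).powersetCard k, F (orderInput q.1) := by
          refine sum_le_sum_of_subset_of_nonneg ?_ fun q hq _ =>
            hnonneg _ (hlevel_low k hk _ (mem_product.mp hq).1)
          intro q hq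
          obtain ⟨⟨π, B⟩, hp, rfl⟩ := mem_image.mp hq
          simp only [mem_sigma, mem_powersetCard] at hp
          obtain ⟨hπ, hB, rfl⟩ := hp
          simp only [mem_product, mem_powersetCard, subset_univ, true_and]
          exact ⟨hmove π hπ B hB, card_image_of_injective B π.injective⟩
      _ = _ := by
          rw [sum_product_right]
          simp
  have hone : ∀ π ∈ low, (H : ℝ) * -F (orderInput π) ≤ 2 * L * ∑ k ∈ Icc 1 K,
      2 * (∑ B ∈ (movable T π).powersetCard k, F (orderInput (moveDown π B))) / N.choose k := by
    intro π hπ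
    have hM := le_card_movable_add T π
    have hpos : ∀ B ⊆ movable T π, B.Nonempty → 0 ≤ F (orderInput (moveDown π B)) :=
      fun B hB hne => hnonneg _ (hlevel_low _ (card_pos.mpr hne) _ (hmove π hπ B hB))
    have h := neg_empty_le_sum_average (movable T π) (Nat.lt_succ_self D) H (hdeg π) hpos
      (show L ^ 2 * H ≤ _ by lia)
    simp only [orderInput_moveDown_empty] at h
    refine h.trans ?_
    rw [← hK]
    refine mul_le_mul_of_nonneg_left (sum_le_sum fun k hk => ?_) (by positivity)
    rw [mem_Icc] at hk
    have hk1 : (0 : ℝ) < (#(movable T π)).choose k := by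
      exact_mod_cast Nat.choose_pos (by lia)
    have hk2 : (0 : ℝ) < N.choose k := by exact_mod_cast Nat.choose_pos (by lia)
    have hch : (N.choose k : ℝ) ≤ 2 * (#(movable T π)).choose k := by
      exact_mod_cast choose_le_two_mul_choose hM
        ((Nat.mul_le_mul_left _ hk.2).trans (hKN.trans hM))
    have hs : 0 ≤ ∑ B ∈ (movable T π).powersetCard k, F (orderInput (moveDown π B)) :=
      sum_nonneg fun B hB => by
        rw [mem_powersetCard] at hB
        exact hpos B hB.1 (card_pos.mp (by lia))
    rw [div_le_div_iff₀ hk1 hk2]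
    nlinarith
  have hL0 : (0 : ℝ) < L := by positivity
  have hlevels : ∑ k ∈ Icc 1 K, ∑ π ∈ level k, F (orderInput π) ≤
      ∑ π ∈ lowᶜ, F (orderInput π) := by
    rw [← sum_biUnion]
    · refine sum_le_sum_of_subset_of_nonneg ?_ fun π hπ _ => hnonneg π (mem_compl.mp hπ)
      intro π hπ
      obtain ⟨k, hk, hπk⟩ := mem_biUnion.mp hπ
      exact mem_compl.mpr (hlevel_low k (mem_Icc.mp hk).1 π hπk)
    · intro k _ l _ hkl
      rw [Function.onFun, disjoint_left]
      intro π hπ hπ'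
      simp only [hlevel, mem_filter, mem_univ, true_and] at hπ hπ'
      obtain ⟨x, hx, rfl⟩ := hπ
      obtain ⟨y, hy, rfl⟩ := hπ'
      obtain rfl : x = y := by rw [hx] at hy; exact LOPOut.minimal.inj hy
      exact hkl rfl
  have htotal : (H : ℝ) * ∑ π ∈ low, -F (orderInput π) ≤
      4 * L * ∑ π ∈ lowᶜ, F (orderInput π) := by
    calc (H : ℝ) * ∑ π ∈ low, -F (orderInput π)
        = ∑ π ∈ low, (H : ℝ) * -F (orderInput π) := mul_sum _ _ _
      _ ≤ _ := sum_le_sum hone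
      _ = 4 * L * ∑ k ∈ Icc 1 K, (∑ π ∈ low, ∑ B ∈ (movable T π).powersetCard k,
            F (orderInput (moveDown π B))) / N.choose k := by
          rw [← mul_sum, sum_comm, mul_sum, mul_sum]
          refine sum_congr rfl fun k _ => ?_
          rw [← sum_div, ← mul_sum]
          ring
      _ ≤ 4 * L * ∑ k ∈ Icc 1 K, ∑ π ∈ level k, F (orderInput π) := by
          gcongr with k hk
          rw [mem_Icc] at hk
          have hk2 : (0 : ℝ) < N.choose k := by exact_mod_cast Nat.choose_pos (by lia)
          rw [div_le_iff₀ hk2, mul_comm]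
          exact hcount k hk.1
      _ ≤ _ := by gcongr
  have hHL : (H : ℝ) = 4 * L := by simp [hH]
  rw [hHL, sum_neg_distrib] at htotal
  have := le_of_mul_le_mul_left htotal (by positivity)
  rw [← sum_add_sum_compl low]
  linarith

end Expectation
/-! ### The lower bound for reductions to Strong Avoid -/

/-- A function of `r` bits, each of degree at most `c`, has degree at most `r * c`: sum over the
bit patterns. -/
theorem ite_bits_mem_degreeLE {U : Type} [DecidableEq U] {r c : ℕ} {x : Finset U → Fin r → Bool}
    (hx : ∀ j b, (fun B => if x B j = b then (1 : ℝ) else 0) ∈ degreeLE U c)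
    (p : (Fin r → Bool) → Prop) [DecidablePred p] :
    (fun B => if p (x B) then (1 : ℝ) else 0) ∈ degreeLE U (r * c) := by
  have h : ∀ β : Fin r → Bool, ∏ j, (fun B => if x B j = β j then (1 : ℝ) else 0) ∈
      degreeLE U (r * c) := fun β => by
    simpa using prod_mem_degreeLE univ fun j _ => hx j (β j)
  have hsum := (degreeLE U (r * c)).sum_mem (t := univ.filter p) fun β _ => h β
  refine (congrArg (· ∈ degreeLE U (r * c)) (funext fun B => ?_)).mp hsum
  have hprod : ∀ β : Fin r → Bool,
      ∏ j, (if x B j = β j then (1 : ℝ) else 0) = if x B = β then 1 else 0 := by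
    intro β
    rw [prod_boole]
    simp [funext_iff]
  simp only [Finset.sum_apply, Finset.prod_apply, hprod]
  rw [sum_ite_eq]
  simp

/-- A linear order has no violations, so its only solution is its least element. -/
theorem exists_least_of_LOPSol {N : ℕ} {π : Equiv.Perm (Fin N)} {o : LOPOut (Fin N)}
    (h : LOPSol (fun a b => orderInput π (a, b)) o) :
    ∃ x, o = .minimal x ∧ ∀ u, π x ≤ π u := by
  cases o with
  | minimal x =>
    refine ⟨x, rfl, fun u => ?_⟩
    rcases eq_or_ne u x with rfl | hu
    · exact le_rfl
    · exact (of_decide_eq_true (h u hu)).le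
  | violation x y z =>
    obtain ⟨hxy, -, h⟩ := h
    have hne := π.injective.ne hxy
    simp only [orderInput, decide_eq_true_eq, decide_eq_false_iff_not] at h
    exfalso
    rcases h with h | ⟨h1, h2⟩ | ⟨h1, h2, h3⟩
    · exact h.false
    · exact hne (le_antisymm (not_lt.mp h2) (not_lt.mp h1))
    · exact h3 (h1.trans h2)

/-- The lower bound on the depth `d` of a reduction from the linear ordering problem on `Fin N` to
Strong Avoid. For each point `y`, the expected number of preimages of `y` over random linear orders
is at least `1`; but the domain is smaller than the codomain. -/
theorem card_lt_of_strongAvoid_formulation {N m d : ℕ}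
    (f : (Fin N × Fin N → Bool) → (Fin (2 ^ m) × Fin (m + 1) → Bool))
    (g : Fin (2 ^ m + 1) → (Fin N × Fin N → Bool) → LOPOut (Fin N))
    (hf : ∀ i, DepthLE (fun x => f x i) d) (hg : ∀ y, DepthLE (g y) d)
    (hcorrect : ∀ x y, (∀ a, decodeFun (f x) a ≠ y) →
      LOPSol (fun a b => x (a, b)) (g y x)) :
    N < 2 * (2 * d + 1) * (((m + 1) * (2 * d) + 1) ^ 2 * (4 * ((m + 1) * (2 * d) + 1))) := by
  by_contra! hN
  set F : Fin (2 ^ m + 1) → (Fin N × Fin N → Bool) → ℝ := fun y x =>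
    ∑ a, (if decodeFun (f x) a = y then 1 else 0) - 1 with hFdef
  have hsum : ∀ x, ∑ y, F y x = -1 := by
    intro x
    simp only [hFdef, sum_sub_distrib]
    rw [sum_comm]
    simp
  have hF : ∀ y, 0 ≤ ∑ π : Equiv.Perm (Fin N), F y (orderInput π) := by
    intro y
    obtain ⟨T, hT, hTg⟩ := hg y
    refine sum_orderInput_nonneg (D := (m + 1) * (2 * d)) T (F y) (fun π => ?_) (fun π hπ => ?_)
      (le_trans ?_ hN)
    · refine (degreeLE _ _).sub_mem ?_ (one_mem_degreeLE _)
      have hbits : ∀ a, (fun B => if decodeFun (f (orderInput (moveDown π B))) a = y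
          then (1 : ℝ) else 0) ∈ degreeLE (Fin N) ((m + 1) * (2 * d)) := by
        intro a
        refine ite_bits_mem_degreeLE (x := fun B j => f (orderInput (moveDown π B)) (a, j))
          (fun j b => ?_) (fun β => decodeFun (fun q => β q.2) a = y)
        obtain ⟨S, hS, hSf⟩ := hf (a, j)
        simp only [← hSf]
        exact degreeLE_mono (Nat.mul_le_mul_left 2 hS)
          (S.ite_eval_mem_degreeLE (orderInput_moveDown_mem_degreeLE π) b)
      convert (degreeLE (Fin N) ((m + 1) * (2 * d))).sum_mem (t := univ) fun a _ => hbits a using 1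
      ext B
      simp
    · by_cases h : ∀ a, decodeFun (f (orderInput π)) a ≠ y
      · obtain ⟨x, hx, hmin⟩ := exists_least_of_LOPSol (hcorrect _ y h)
        obtain ⟨u, hu⟩ := hπ x ((hTg _).trans hx)
        exact absurd hu (not_lt.mpr (hmin u))
      · push Not at h
        obtain ⟨a, ha⟩ := h
        have := single_le_sum (s := univ)
          (f := fun a => if decodeFun (f (orderInput π)) a = y then (1 : ℝ) else 0)
          (fun b _ => by positivity) (mem_univ a)
        simp only [ha, if_true] at this
        simpa [hFdef] using this
    · gcongr
  have h1 : 0 ≤ ∑ y, ∑ π : Equiv.Perm (Fin N), F y (orderInput π) :=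
    sum_nonneg fun y _ => hF y
  rw [sum_comm] at h1
  simp only [hsum, sum_const, card_univ, nsmul_eq_mul, mul_neg, mul_one] at h1
  have : (0 : ℝ) < Fintype.card (Equiv.Perm (Fin N)) := by exact_mod_cast Fintype.card_pos
  linarith

/-! ### Asymptotics -/

theorem size_LOP (n : ℕ) : (LOP n).size = 2 ^ n * 2 ^ n := by
  change Fintype.card (Fin (2 ^ n) × Fin (2 ^ n)) = _
  simp

theorem size_strongAvoid (m : ℕ) : (StrongAvoid m).size = 2 ^ m * (m + 1) := by
  change Fintype.card (Fin (2 ^ m) × Fin (m + 1)) = _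
  simp

theorem log_size_LOP (n : ℕ) : Real.log (LOP n).size = 2 * n * Real.log 2 := by
  rw [size_LOP, ← pow_add, Nat.cast_pow, Real.log_pow]
  push_cast
  ring

/-- A polylogarithmic bound on the complexity of a reduction from `LOP n` to Strong Avoid is
polynomial in `n`, so it eventually violates `card_lt_of_strongAvoid_formulation`. -/
theorem exists_depth_bound_le {p : ℕ → ℝ} (hp : IsPolylog p) :
    ∃ n, ∀ m d : ℕ, (m : ℝ) + d ≤ p (LOP n).size →
      2 * (2 * d + 1) * (((m + 1) * (2 * d) + 1) ^ 2 * (4 * ((m + 1) * (2 * d) + 1))) ≤ 2 ^ n := by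
  obtain ⟨k, hk⟩ := hp
  obtain ⟨C, hC⟩ := hk.bound
  have htend : Filter.Tendsto (fun n => (LOP n).size) Filter.atTop Filter.atTop := by
    refine Filter.tendsto_atTop_mono (fun n => ?_) Filter.tendsto_id
    rw [size_LOP]
    exact Nat.lt_two_pow_self.le.trans (Nat.le_mul_of_pos_right _ (by positivity))
  set E : ℝ := |C| * 2 ^ k + 1 with hE
  have hE0 : 0 < E := by positivity
  have hexp := (isLittleO_pow_const_const_pow_of_one_lt (R := ℝ) (7 * k) one_lt_two).def
    (show (0 : ℝ) < 1 / (432 * E ^ 7) by positivity)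
  obtain ⟨n, ⟨hn, hexp⟩, hn1⟩ :=
    ((htend.eventually hC).and hexp |>.and (Filter.eventually_ge_atTop 1)).exists
  refine ⟨n, fun m d hmd => ?_⟩
  have hn1' : (1 : ℝ) ≤ n := by exact_mod_cast hn1
  have hX : ((m + d + 1 : ℕ) : ℝ) ≤ E * n ^ k := by
    have h1 : |Real.log (LOP n).size ^ k| ≤ 2 ^ k * n ^ k := by
      rw [abs_pow, log_size_LOP, ← mul_pow]
      gcongr
      rw [abs_of_nonneg (by positivity)]
      have := Real.log_two_lt_d9
      nlinarith
    have h2 : p (LOP n).size ≤ |C| * (2 ^ k * n ^ k) := by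
      refine (le_abs_self _).trans (hn.trans ?_)
      rw [Real.norm_eq_abs]
      gcongr
      exact le_abs_self C
    have h3 : (1 : ℝ) ≤ n ^ k := one_le_pow₀ hn1'
    push_cast
    rw [hE]
    linarith
  have hnat : 2 * (2 * d + 1) * (((m + 1) * (2 * d) + 1) ^ 2 * (4 * ((m + 1) * (2 * d) + 1))) ≤
      432 * (m + d + 1) ^ 7 := by
    set X := m + d + 1 with hXdef
    have h1 : 2 * d + 1 ≤ 2 * X := by lia
    have h2 : (m + 1) * (2 * d) + 1 ≤ 3 * X ^ 2 := by
      have : (m + 1) * d ≤ X * X := Nat.mul_le_mul (by lia) (by lia)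
      have : 1 ≤ X * X := Nat.mul_pos (by lia) (by lia)
      nlinarith
    calc _ ≤ 2 * (2 * X) * ((3 * X ^ 2) ^ 2 * (4 * (3 * X ^ 2))) := by gcongr
      _ = 432 * X ^ 7 := by ring
  have hreal : ((432 * (m + d + 1) ^ 7 : ℕ) : ℝ) ≤ 2 ^ n := by
    calc ((432 * (m + d + 1) ^ 7 : ℕ) : ℝ) = 432 * ((m + d + 1 : ℕ) : ℝ) ^ 7 := by push_cast; ring
      _ ≤ 432 * (E * n ^ k) ^ 7 := by gcongr
      _ = 432 * E ^ 7 * n ^ (7 * k) := by ring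
      _ ≤ 2 ^ n := by
        rw [Real.norm_of_nonneg (by positivity), Real.norm_of_nonneg (by positivity),
          div_mul_eq_mul_div, one_mul, le_div_iff₀ (by positivity)] at hexp
        linarith
  exact hnat.trans (by exact_mod_cast hreal)

theorem LOP_not_mem_dtClass_strongAvoid : LOP ∉ dtClass StrongAvoid := by
  rintro ⟨p, hp, hred⟩
  obtain ⟨n, hn⟩ := exists_depth_bound_le hp
  obtain ⟨m, φ, d, ⟨hf, hg⟩, hc⟩ := hred n
  refine absurd (hn m d (le_trans ?_ hc)) (not_le.mpr
    (card_lt_of_strongAvoid_formulation φ.f φ.g hf hg φ.correct))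
  gcongr
  rw [size_strongAvoid, Real.le_logb_iff_rpow_le one_lt_two (by positivity), Real.rpow_natCast]
  exact_mod_cast Nat.le_mul_of_pos_right _ (by lia)

/-! ### Membership in `TFΣ₂` -/

/-- The verifier of `LOP`: a claimed minimal `x` is compared to the universally quantified `y`;
violations are checked directly. -/
def lopVerifier {U : Type} [DecidableEq U] : LOPOut U → U → DecisionTree (U × U) Bool
  | .minimal x, y => if y = x then .leaf true else .query (x, y) (.leaf false) (.leaf true)
  | .violation x y z, _ =>
    if x ≠ y ∧ y ≠ z then
      .query (x, x)
        (.query (x, y)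
          (.query (y, x) (.leaf true) (.leaf false))
          (.query (y, z) (.leaf false) (.query (x, z) (.leaf true) (.leaf false))))
        (.leaf true)
    else .leaf false

theorem depth_lopVerifier_le {U : Type} [DecidableEq U] (o : LOPOut U) (y : U) :
    (lopVerifier o y).depth ≤ 4 := by
  cases o <;> simp only [lopVerifier] <;> split_ifs <;> simp [DecisionTree.depth]

theorem LOPSol_iff_forall_lopVerifier {U : Type} [DecidableEq U] [Nonempty U]
    (x : U × U → Bool) (o : LOPOut U) :
    LOPSol (fun a b => x (a, b)) o ↔ ∀ y, (lopVerifier o y).eval x = true := by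
  cases o with
  | minimal a =>
    refine forall_congr' fun y => ?_
    by_cases h : y = a <;> simp [lopVerifier, DecisionTree.eval, h]
  | violation a b c =>
    by_cases h : a ≠ b ∧ b ≠ c
    · cases h1 : x (a, a) <;> cases h2 : x (a, b) <;> cases h3 : x (b, a) <;>
        cases h4 : x (b, c) <;> cases h5 : x (a, c) <;>
        simp [LOPSol, lopVerifier, DecisionTree.eval, h, h1, h2, h3, h4, h5]
    · simp only [LOPSol, lopVerifier, if_neg h, DecisionTree.eval]
      simp only [← and_assoc, h, false_and, Bool.false_eq_true, forall_const]

theorem LOP_mem_TFSigma2dt : LOP ∈ TFSigma2dt := by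
  refine ⟨fun N => Real.log N / Real.log 2 + 4, ⟨1, ?_⟩, fun n => ?_⟩
  · have hlog : Filter.Tendsto (fun N : ℕ => Real.log N) Filter.atTop Filter.atTop :=
      Real.tendsto_log_atTop.comp tendsto_natCast_atTop_atTop
    simp only [pow_one]
    refine Asymptotics.IsBigO.add ?_ ?_
    · simp only [div_eq_inv_mul]
      exact (Asymptotics.isBigO_refl _ _).const_mul_left _
    · exact (Asymptotics.isLittleO_const_left.mpr
        (Or.inr (Filter.tendsto_abs_atTop_atTop.comp hlog))).isBigO
  · have hp : Real.log (LOP n).size / Real.log 2 + 4 = 2 * n + 4 := by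
      rw [log_size_LOP, mul_div_assoc, div_self (Real.log_pos one_lt_two).ne', mul_one]
    let e : (Fin n → Bool) ≃ Fin (2 ^ n) := Fintype.equivFinOfCardEq (by simp)
    refine ⟨n, ?_, fun o z => lopVerifier o (e z), fun o z => ?_, fun x o => ?_⟩
    · refine le_trans ?_ hp.ge
      have : (0 : ℝ) ≤ n := n.cast_nonneg
      linarith
    · refine le_trans ?_ hp.ge
      have h := (Nat.cast_le (α := ℝ)).mpr (depth_lopVerifier_le o (e z))
      have : (0 : ℝ) ≤ n := n.cast_nonneg
      refine h.trans ?_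
      push_cast
      linarith
    · exact (LOPSol_iff_forall_lopVerifier x o).trans
        (e.forall_congr_right (q := fun y => (lopVerifier o y).eval x = true)).symm

end BlackBox

theorem theorem1 :
    BlackBox.LOP ∈ BlackBox.TFSigma2dt ∧
      BlackBox.LOP ∉ BlackBox.dtClass BlackBox.StrongAvoid :=
  ⟨BlackBox.LOP_mem_TFSigma2dt, BlackBox.LOP_not_mem_dtClass_strongAvoid⟩
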